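/- Let $U$ be uniformly distributed on $[0,1]$. A probability measure $\mathcal{Q}$ on $\mathbb{R}$ is called \emph{sub-uniform} if it is dominated by the law of $U$ in the convex order, that is, $\int h \, d\mathcal{Q} \le \mathrm{E}\{h(U)\}$ for every convex function $h:\mathbb{R}\to\mathbb{R}$ for which both expectations exist (as extended real numbers). On a probability space with null probability measure $\mathrm{P}_0$, let $D$ be a random element of an arbitrary measurable space (the data), let $Y$ be a random element of an arbitrary measurable space (the randomisation device), independent of $D$, and let $f'$ be a real-valued measurable function such that the law of $f'(D,Y)$ under $\mathrm{P}_0$ is absolutely continuous. Put \[ R' = \mathrm{P}_0\{f'(D^*,Y^*) \ge f'(D,Y)\}, \] where $(D^*,Y^*)$ is a replicate of $(D,Y)$ under $\mathrm{P}_0$, independent of $(D,Y)$, and the probability is taken over $(D^*,Y^*)$ with $(D,Y)$ held fixed. Any random variable $Q'$ obtained in this way as $Q' = \mathrm{E}_0(R' \mid D)$ is called a \emph{generalised mid-p-value}. Then a measure $\mathcal{Q}$ on $\mathbb{R}$ is a sub-uniform probability measure if and only if there exists a generalised mid-p-value (for some choice of probability space, $D$, $Y$ and $f'$) whose distribution under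 $\mathrm{P}_0$ is $\mathcal{Q}$. -/

import Mathlib

open MeasureTheory ProbabilityTheory

universe u v w

noncomputable section

/-- The expectation of `h` under `μ` exists, possibly with an infinite value: the positive part or
the negative part of `h` has a finite integral. -/
def ExpectationExists (μ : Measure ℝ) (h : ℝ → ℝ) : Prop :=
  ∫⁻ x, ENNReal.ofReal (h x) ∂μ ≠ ⊤ ∨ ∫⁻ x, ENNReal.ofReal (-h x) ∂μ ≠ ⊤

/-- The extended-real expectation of `h` under `μ`, meaningful when `ExpectationExists μ h`. -/
def extExpectation (μ : Measure ℝ) (h : ℝ → ℝ) : EReal :=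
  ((∫⁻ x, ENNReal.ofReal (h x) ∂μ : ENNReal) : EReal)
    - ((∫⁻ x, ENNReal.ofReal (-h x) ∂μ : ENNReal) : EReal)

/-- The convex order between laws on the real line: `E_μ h ≤ E_ν h` for every convex `h : ℝ → ℝ`
for which both expectations exist. Infinite values are allowed: asking for finite expectations
only would make the comparison void for laws without a mean, such as the Cauchy law. -/
def ConvexOrderLE (μ ν : Measure ℝ) : Prop :=
  ∀ h : ℝ → ℝ, ConvexOn ℝ Set.univ h → ExpectationExists μ h → ExpectationExists ν h →
    extExpectation μ h ≤ extExpectation ν h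

/-- The uniform law on the unit interval. -/
def uniformLaw : Measure ℝ := volume.restrict (Set.Icc 0 1)

/-- A law on the real line is sub-uniform if it is dominated by the uniform law on the unit
interval in the convex order. -/
def IsSubUniform (μ : Measure ℝ) : Prop := ConvexOrderLE μ uniformLaw

/-- The p-value of the real test statistic `T` under the null probability measure `P`: at the
outcome `ω`, the null probability that a replicate of `T` is at least as large as `T ω`. -/
def pValue {Ω : Type u} [MeasurableSpace Ω] (P : Measure Ω) (T : Ω → ℝ) (ω : Ω) : ℝ :=
  P.real {ω' | T ω ≤ T ω'}

/-- `f (D, Y)` is a randomised test statistic with data `D` and randomisation device `Y`,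
independent of the data, whose law under the null measure `P` is absolutely continuous. -/
structure IsRandomisedTest {Ω : Type u} {𝒟 : Type v} {𝒴 : Type w} [MeasurableSpace Ω]
    [MeasurableSpace 𝒟] [MeasurableSpace 𝒴] (P : Measure Ω) (D : Ω → 𝒟) (Y : Ω → 𝒴)
    (f : 𝒟 × 𝒴 → ℝ) : Prop where
  measurable_data : Measurable D
  measurable_device : Measurable Y
  indep : IndepFun D Y P
  measurable_stat : Measurable f
  absolutelyContinuous : P.map (fun ω => f (D ω, Y ω)) ≪ volume

/-- `Q` is a generalised mid-p-value under the null measure `P`: there are data `D`, a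
randomisation device `Y` and a randomised test statistic `f (D, Y)` such that `Q` is a version of
the conditional expectation, given `D`, of the p-value of `f (D, Y)`. -/
def IsGeneralisedMidPValue {Ω : Type u} [MeasurableSpace Ω] (P : Measure Ω) (Q : Ω → ℝ) : Prop :=
  ∃ (𝒟 : Type v) (m𝒟 : MeasurableSpace 𝒟) (𝒴 : Type w) (_ : MeasurableSpace 𝒴)
    (D : Ω → 𝒟) (Y : Ω → 𝒴) (f : 𝒟 × 𝒴 → ℝ),
    IsRandomisedTest P D Y f ∧
      Q =ᵐ[P] P[pValue P (fun ω => f (D ω, Y ω)) | MeasurableSpace.comap D m𝒟]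

end

open Filter Topology unitInterval
open scoped CompactlySupported

/-! Necessity: the survival function of an atomless law is continuous, so the p-value `R` is
uniform, and conditional Jensen puts the law of `E(R | D)` below the uniform law
(`convexOrderLE_map_condExp`).

Sufficiency is Strassen's theorem. A sub-uniform law lives on the unit interval and admits a
coupling `(X, U)` with `U` uniform and `E(U | X) = X` (`exists_martingale_coupling`). Write `U = g
(X, V)` with `V` uniform and independent of `X` (`exists_measurable_map_prod_eq`). With data `X`,
device `V` and statistic `-U`, the p-value is `U` itself, so its conditional expectation is `X`.

The coupling comes from duality: a linear functional is prescribed on the functions that test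
marginals and martingale property, extended positively by M. Riesz, and represented as a measure by
Riesz–Markov. -/

theorem expectationExists_of_integrable {μ : Measure ℝ} {h : ℝ → ℝ} (hi : Integrable h μ) :
    ExpectationExists μ h :=
  Or.inl hi.lintegral_lt_top.ne

theorem extExpectation_eq_integral {μ : Measure ℝ} {h : ℝ → ℝ} (hi : Integrable h μ) :
    extExpectation μ h = ((∫ x, h x ∂μ : ℝ) : EReal) := by
  have h1 := hi.lintegral_lt_top.ne
  have h2 := hi.neg.lintegral_lt_top.ne
  simp only [Pi.neg_apply] at h2
  rw [integral_eq_lintegral_pos_part_sub_lintegral_neg_part hi, extExpectation, EReal.coe_sub,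
    EReal.coe_ennreal_toReal h1, EReal.coe_ennreal_toReal h2]

theorem Continuous.integrable_of_ae_mem_compact {μ : Measure ℝ} [IsFiniteMeasure μ] {h : ℝ → ℝ}
    (hc : Continuous h) {K : Set ℝ} (hK : IsCompact K) (hs : ∀ᵐ x ∂μ, x ∈ K) :
    Integrable h μ := by
  obtain ⟨C, hC⟩ := hK.exists_bound_of_continuousOn hc.continuousOn
  exact .of_bound hc.aestronglyMeasurable C (hs.mono hC)

theorem ConvexOn.continuous_of_univ {h : ℝ → ℝ} (hh : ConvexOn ℝ Set.univ h) : Continuous h :=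
  continuousOn_univ.1 (hh.continuousOn isOpen_univ)

instance isProbabilityMeasure_uniformLaw : IsProbabilityMeasure uniformLaw :=
  ⟨by simp [uniformLaw]⟩

theorem ae_mem_Icc_uniformLaw : ∀ᵐ x ∂uniformLaw, x ∈ Set.Icc (0 : ℝ) 1 :=
  ae_restrict_mem measurableSet_Icc

/-! ### Uniformity of the p-value -/

theorem antitone_measureReal_Ici (ν : Measure ℝ) [IsFiniteMeasure ν] :
    Antitone fun x => ν.real (Set.Ici x) :=
  fun _ _ hxy => measureReal_mono (Set.Ici_subset_Ici.2 hxy)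

theorem continuous_measureReal_Ici (ν : Measure ℝ) [IsFiniteMeasure ν] [NullSingletonClass ν] :
    Continuous fun x => ν.real (Set.Ici x) := by
  have hG : (fun x => ν.real (Set.Ici x)) =
      fun x => ∫ y, (Set.Ici x).indicator (fun _ => (1 : ℝ)) y ∂ν := by
    ext x
    rw [integral_indicator_const _ measurableSet_Ici]
    simp
  rw [hG, continuous_iff_continuousAt]
  intro x
  refine continuousAt_of_dominated (bound := fun _ => 1) ?_ ?_ (integrable_const 1) ?_
  · exact .of_forall fun x => (measurable_const.indicator measurableSet_Ici).aestronglyMeasurable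
  · exact .of_forall fun x => .of_forall fun y => by
      simp only [Set.indicator]
      split_ifs <;> simp
  -- The indicator of `[z, ∞)` at `y` jumps, as `z` varies, only at `z = y`; the exceptional `y = x`
  -- is null.
  · filter_upwards [(Set.countable_singleton x).ae_notMem ν] with y hy
    rcases lt_or_gt_of_ne (fun h : y = x => hy (by simp [h])) with h | h
    · refine (continuousAt_const (y := (0 : ℝ))).congr ?_
      filter_upwards [lt_mem_nhds h] with z hz
      simp [Set.indicator, hz]
    · refine (continuousAt_const (y := (1 : ℝ))).congr ?_
      filter_upwards [gt_mem_nhds h] with z hz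
      simp [Set.indicator, hz.le]

theorem measureReal_Ici_eq_one_sub_cdf (ν : Measure ℝ) [IsProbabilityMeasure ν] [NullSingletonClass ν]
    (x : ℝ) : ν.real (Set.Ici x) = 1 - cdf ν x := by
  rw [ProbabilityTheory.cdf_eq_real, ← probReal_compl_eq_one_sub measurableSet_Iic, Set.compl_Iic]
  exact (measureReal_congr Ioi_ae_eq_Ici).symm

/-- The sublevel set is a closed ray `[a, ∞)`, and continuity forces the survival function to equal
`t` at `a`. The bound `t < 1` keeps `a` finite. -/
theorem measure_survival_le (ν : Measure ℝ) [IsProbabilityMeasure ν] [NullSingletonClass ν] {t : ℝ}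
    (h0 : 0 ≤ t) (h1 : t < 1) : ν {x | ν.real (Set.Ici x) ≤ t} = ENNReal.ofReal t := by
  set G : ℝ → ℝ := fun x => ν.real (Set.Ici x) with hG
  have hanti : Antitone G := antitone_measureReal_Ici ν
  have hcont : Continuous G := continuous_measureReal_Ici ν
  have hcdf : G = fun x => 1 - cdf ν x := funext (measureReal_Ici_eq_one_sub_cdf ν)
  have htop : Tendsto G atTop (𝓝 0) := by
    rw [hcdf]
    simpa using (tendsto_cdf_atTop ν).const_sub 1
  have hbot : Tendsto G atBot (𝓝 1) := by
    rw [hcdf]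
    simpa using (tendsto_cdf_atBot ν).const_sub 1
  change ν {x | G x ≤ t} = _
  rcases Set.eq_empty_or_nonempty {x | G x ≤ t} with he | hne
  -- The survival function tends to `0`, so only level `0` can be missed.
  · have : t = 0 := by
      by_contra hne
      obtain ⟨x, hx⟩ := (htop.eventually (gt_mem_nhds (lt_of_le_of_ne h0 (Ne.symm hne)))).exists
      exact (he ▸ (show x ∈ {x | G x ≤ t} from hx.le) : x ∈ (∅ : Set ℝ))
    rw [he, this]
    simp
  · obtain ⟨b, hb⟩ := (hbot.eventually (lt_mem_nhds h1)).exists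
    have hbdd : BddBelow {x | G x ≤ t} := by
      refine ⟨b, fun x hx => ?_⟩
      by_contra! hlt
      exact absurd (hb.trans_le (hanti hlt.le)) (not_lt.2 hx)
    have hmem : G (sInf {x | G x ≤ t}) ≤ t :=
      (isClosed_le hcont continuous_const).csInf_mem hne hbdd
    set a := sInf {x | G x ≤ t}
    have hset : {x | G x ≤ t} = Set.Ici a :=
      Set.Subset.antisymm (fun x hx => csInf_le hbdd hx) fun x hx => (hanti hx).trans hmem
    have hge : t ≤ G a := by
      refine ge_of_tendsto (hcont.continuousAt.continuousWithinAt (s := Set.Iio a)) ?_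
      filter_upwards [self_mem_nhdsWithin] with x hx
      by_contra! hlt
      exact not_lt.2 (csInf_le hbdd hlt.le) hx
    rw [hset, ← le_antisymm hmem hge, hG, ofReal_measureReal]

theorem map_survival_eq_uniformLaw (ν : Measure ℝ) [IsProbabilityMeasure ν] [NullSingletonClass ν] :
    ν.map (fun x => ν.real (Set.Ici x)) = uniformLaw := by
  have hm : Measurable fun x => ν.real (Set.Ici x) := (continuous_measureReal_Ici ν).measurable
  have : IsProbabilityMeasure (ν.map fun x => ν.real (Set.Ici x)) :=
    Measure.isProbabilityMeasure_map hm.aemeasurable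
  refine Measure.ext_of_Iic _ _ fun t => ?_
  rw [Measure.map_apply hm measurableSet_Iic, uniformLaw, Measure.restrict_apply measurableSet_Iic,
    Set.inter_comm, ← Set.Ici_inter_Iic, Set.inter_assoc, Set.Iic_inter_Iic, Set.Ici_inter_Iic,
    Real.volume_Icc, sub_zero]
  change ν {x | ν.real (Set.Ici x) ≤ t} = _
  rcases lt_or_ge t 0 with h0 | h0
  · have : {x | ν.real (Set.Ici x) ≤ t} = ∅ :=
      Set.eq_empty_of_forall_notMem fun x hx => absurd (measureReal_nonneg.trans hx) (not_le.2 h0)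
    rw [this, measure_empty, ENNReal.ofReal_of_nonpos ((min_le_right _ _).trans h0.le)]
  rcases lt_or_ge t 1 with h1 | h1
  · rw [measure_survival_le ν h0 h1, min_eq_right h1.le]
  · have : {x | ν.real (Set.Ici x) ≤ t} = Set.univ :=
      Set.eq_univ_of_forall fun x => measureReal_le_one.trans h1
    rw [this, measure_univ, min_eq_left h1, ENNReal.ofReal_one]

theorem pValue_eq_comp {Ω : Type*} [MeasurableSpace Ω] (P : Measure Ω) {T : Ω → ℝ}
    (hT : Measurable T) :
    pValue P T = (fun x => (P.map T).real (Set.Ici x)) ∘ T := by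
  ext ω
  simp only [pValue, Function.comp_apply, map_measureReal_apply hT measurableSet_Ici]
  rfl

theorem measurable_pValue {Ω : Type*} [MeasurableSpace Ω] (P : Measure Ω) [IsFiniteMeasure P]
    {T : Ω → ℝ} (hT : Measurable T) : Measurable (pValue P T) := by
  rw [pValue_eq_comp P hT]
  exact (antitone_measureReal_Ici _).measurable.comp hT

theorem map_pValue_eq_uniformLaw {Ω : Type*} [MeasurableSpace Ω] (P : Measure Ω)
    [IsProbabilityMeasure P] {T : Ω → ℝ} (hT : Measurable T) (hac : P.map T ≪ volume) :
    P.map (pValue P T) = uniformLaw := by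
  have : IsProbabilityMeasure (P.map T) := Measure.isProbabilityMeasure_map hT.aemeasurable
  have : NullSingletonClass (P.map T) := ⟨fun x => hac (measure_singleton x)⟩
  rw [pValue_eq_comp P hT, ← Measure.map_map (antitone_measureReal_Ici _).measurable hT,
    map_survival_eq_uniformLaw]

theorem integrable_comp_of_map_eq_uniformLaw {Ω : Type*} [MeasurableSpace Ω] {P : Measure Ω}
    {R : Ω → ℝ} (hR : Measurable R) (hlaw : P.map R = uniformLaw) {h : ℝ → ℝ}
    (hc : Continuous h) : Integrable (h ∘ R) P := by
  refine (integrable_map_measure hc.aestronglyMeasurable hR.aemeasurable).1 ?_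
  rw [hlaw]
  exact hc.integrable_of_ae_mem_compact isCompact_Icc ae_mem_Icc_uniformLaw

/-! ### Necessity -/

theorem convexOrderLE_map_condExp {Ω : Type*} {m m0 : MeasurableSpace Ω} {P : Measure Ω}
    [IsProbabilityMeasure P] (hm : m ≤ m0) {R : Ω → ℝ} (hR : Measurable R)
    (hlaw : P.map R = uniformLaw) : ConvexOrderLE (P.map P[R | m]) uniformLaw := by
  intro h hh _ _
  have hc := hh.continuous_of_univ
  have hRi : Integrable R P := integrable_comp_of_map_eq_uniformLaw hR hlaw continuous_id
  have hhRi : Integrable (h ∘ R) P := integrable_comp_of_map_eq_uniformLaw hR hlaw hc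
  have hRmem : ∀ᵐ ω ∂P, R ω ∈ Set.Icc (0 : ℝ) 1 :=
    ae_of_ae_map hR.aemeasurable (hlaw ▸ ae_mem_Icc_uniformLaw)
  have hQm : AEMeasurable P[R | m] P := integrable_condExp.aemeasurable
  have hQmem : ∀ᵐ ω ∂P, P[R | m] ω ∈ Set.Icc (0 : ℝ) 1 :=
    (convex_Icc 0 1).condExp_mem hm hRi isClosed_Icc hRmem
  have : IsProbabilityMeasure (P.map P[R | m]) := Measure.isProbabilityMeasure_map hQm
  have hQi : Integrable h (P.map P[R | m]) :=
    hc.integrable_of_ae_mem_compact isCompact_Icc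
      ((ae_map_iff hQm measurableSet_Icc).2 hQmem)
  have hUi : Integrable h uniformLaw :=
    hc.integrable_of_ae_mem_compact isCompact_Icc ae_mem_Icc_uniformLaw
  rw [extExpectation_eq_integral hQi, extExpectation_eq_integral hUi, EReal.coe_le_coe_iff,
    integral_map hQm hc.aestronglyMeasurable, ← hlaw,
    integral_map hR.aemeasurable hc.aestronglyMeasurable]
  calc ∫ ω, h (P[R | m] ω) ∂P ≤ ∫ ω, (P[h ∘ R | m]) ω ∂P :=
        integral_mono_ae ((integrable_map_measure hc.aestronglyMeasurable hQm).1 hQi)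
          integrable_condExp (hh.map_condExp_le_of_finiteDimensional hm hRi hhRi)
    _ = ∫ ω, h (R ω) ∂P := integral_condExp hm

theorem IsGeneralisedMidPValue.convexOrderLE {Ω : Type*} [MeasurableSpace Ω] {P : Measure Ω}
    [IsProbabilityMeasure P] {Q : Ω → ℝ} (hQ : IsGeneralisedMidPValue P Q) :
    ConvexOrderLE (P.map Q) uniformLaw := by
  obtain ⟨𝒟, m𝒟, 𝒴, m𝒴, D, Y, f, hf, hQ⟩ := hQ
  have hT : Measurable fun ω => f (D ω, Y ω) :=
    hf.measurable_stat.comp (hf.measurable_data.prodMk hf.measurable_device)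
  rw [Measure.map_congr hQ]
  exact convexOrderLE_map_condExp hf.measurable_data.comap_le (measurable_pValue P hT)
    (map_pValue_eq_uniformLaw P hT hf.absolutelyContinuous)

/-! ### Martingale couplings by duality -/

/-- Applying positivity to `z` and `-z` shows that `B` vanishes on the kernel of `A`, so it descends
to the range, where the M. Riesz extension theorem applies. -/
theorem exists_nonneg_extension_of_range {V E : Type*} [AddCommGroup V] [Module ℝ V]
    [AddCommGroup E] [Module ℝ E] (s : PointedCone ℝ E) (A : V →ₗ[ℝ] E) (B : V →ₗ[ℝ] ℝ)
    (hpos : ∀ z, A z ∈ s → 0 ≤ B z) (hcof : ∀ y, ∃ z, A z + y ∈ s) :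
    ∃ g : E →ₗ[ℝ] ℝ, (∀ z, g (A z) = B z) ∧ ∀ x ∈ s, 0 ≤ g x := by
  obtain ⟨r, hr⟩ := A.rangeRestrict.exists_rightInverse_of_surjective
    (LinearMap.range_eq_top.2 A.surjective_rangeRestrict)
  have hAr : ∀ y : LinearMap.range A, A (r y) = y := fun y =>
    congrArg Subtype.val (LinearMap.congr_fun hr y)
  have hker : ∀ z, A z = 0 → B z = 0 := fun z hz => by
    have h1 := hpos z (hz ▸ s.zero_mem)
    have h2 := hpos (-z) (by rw [map_neg, hz, neg_zero]; exact s.zero_mem)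
    rw [map_neg] at h2
    linarith
  obtain ⟨g, hg, hgs⟩ := riesz_extension s ⟨LinearMap.range A, B ∘ₗ r⟩
    (fun x hx => hpos (r x) (by rw [hAr]; exact hx))
    (fun y => (hcof y).imp' (fun z => ⟨A z, z, rfl⟩) fun z hz => hz)
  refine ⟨g, fun z => ?_, hgs⟩
  have h1 : g (A z) = B (r ⟨A z, z, rfl⟩) := hg ⟨A z, z, rfl⟩
  have h2 := hker (r ⟨A z, z, rfl⟩ - z) (by rw [map_sub, hAr, sub_self])
  rw [map_sub] at h2
  linarith

/-- The cone of nonnegative continuous functions. -/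
def nonnegCone (X : Type*) [TopologicalSpace X] : PointedCone ℝ C(X, ℝ) where
  carrier := {F | ∀ x, 0 ≤ F x}
  add_mem' hF hG x := add_nonneg (hF x) (hG x)
  zero_mem' _ := le_rfl
  smul_mem' c _ hF x := mul_nonneg c.2 (hF x)

theorem mem_nonnegCone {X : Type*} [TopologicalSpace X] {F : C(X, ℝ)} :
    F ∈ nonnegCone X ↔ ∀ x, 0 ≤ F x := Iff.rfl

theorem exists_measure_of_nonneg_functional {X : Type*} [TopologicalSpace X] [CompactSpace X]
    [T2Space X] [MeasurableSpace X] [BorelSpace X] (g : C(X, ℝ) →ₗ[ℝ] ℝ)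
    (hg : ∀ F ∈ nonnegCone X, 0 ≤ g F) :
    ∃ π : Measure X, IsFiniteMeasure π ∧ ∀ F : C(X, ℝ), ∫ x, F x ∂π = g F := by
  let Λ : C_c(X, ℝ) →ₚ[ℝ] ℝ :=
    { toFun F := g F.toContinuousMap
      map_add' F G := g.map_add _ _
      map_smul' c F := g.map_smul c _
      monotone' F G hFG := by
        have := hg (G.toContinuousMap - F.toContinuousMap) fun x => sub_nonneg.2 (hFG x)
        rw [map_sub] at this
        exact sub_nonneg.1 this }
  have hfin : IsFiniteMeasure (RealRMK.rieszMeasure Λ) :=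
    ⟨(RealRMK.rieszMeasure_le_of_eq_one Λ
      (f := ⟨1, HasCompactSupport.of_compactSpace _⟩) (fun x => by simp) isCompact_univ
      (fun x _ => by simp)).trans_lt ENNReal.ofReal_lt_top⟩
  exact ⟨_, hfin, fun F => RealRMK.integral_rieszMeasure Λ ⟨F, HasCompactSupport.of_compactSpace _⟩⟩

theorem MeasureTheory.Measure.ext_of_forall_integral_continuousMap {X : Type*} [TopologicalSpace X]
    [MeasurableSpace X] [BorelSpace X] [HasOuterApproxClosed X] {μ ν : Measure X}
    [IsFiniteMeasure μ] [IsFiniteMeasure ν] (h : ∀ F : C(X, ℝ), ∫ x, F x ∂μ = ∫ x, F x ∂ν) :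
    μ = ν :=
  ext_of_forall_integral_eq_of_IsFiniteMeasure fun F => h F.toContinuousMap

/-- The function `(x, y) ↦ φ x + ψ y + θ x * (y - x)` on the square. -/
def dualFunction : (C(I, ℝ) × C(I, ℝ) × C(I, ℝ)) →ₗ[ℝ] C(I × I, ℝ) where
  toFun z := ⟨fun p => z.1 p.1 + z.2.1 p.2 + z.2.2 p.1 * ((p.2 : ℝ) - p.1), by fun_prop⟩
  map_add' z w := by
    ext p
    simp
    ring
  map_smul' c z := by
    ext p
    simp
    ring

theorem dualFunction_apply (φ ψ θ : C(I, ℝ)) (p : I × I) :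
    dualFunction (φ, ψ, θ) p = φ p.1 + ψ p.2 + θ p.1 * ((p.2 : ℝ) - p.1) := rfl

theorem ContinuousMap.integrable_of_compactSpace {X : Type*} [TopologicalSpace X] [CompactSpace X]
    [MeasurableSpace X] [BorelSpace X] (μ : Measure X) [IsFiniteMeasure μ] (F : C(X, ℝ)) :
    Integrable F μ :=
  F.continuous.integrable_of_hasCompactSupport (HasCompactSupport.of_compactSpace _)

/-- The functional `(φ, ψ, θ) ↦ ∫ φ ∂μ + ∫ ψ ∂ν`. -/
noncomputable def dualValue (μ ν : Measure I) [IsFiniteMeasure μ] [IsFiniteMeasure ν] :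
    (C(I, ℝ) × C(I, ℝ) × C(I, ℝ)) →ₗ[ℝ] ℝ where
  toFun z := ∫ x, z.1 x ∂μ + ∫ y, z.2.1 y ∂ν
  map_add' z w := by
    simp only [Prod.fst_add, Prod.snd_add, ContinuousMap.add_apply]
    rw [integral_add (z.1.integrable_of_compactSpace μ) (w.1.integrable_of_compactSpace μ),
      integral_add (z.2.1.integrable_of_compactSpace ν) (w.2.1.integrable_of_compactSpace ν)]
    ring
  map_smul' c z := by
    simp [integral_const_mul, mul_add]

theorem dualValue_apply (μ ν : Measure I) [IsFiniteMeasure μ] [IsFiniteMeasure ν]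
    (φ ψ θ : C(I, ℝ)) : dualValue μ ν (φ, ψ, θ) = ∫ x, φ x ∂μ + ∫ y, ψ y ∂ν := rfl

/-- Take the supremum over `x` of the affine functions `y ↦ -φ x - θ x * (y - x)`: the one based at
`y` gives the lower bound, the hypothesis the upper. -/
theorem exists_convexOn_between {φ ψ θ : C(I, ℝ)}
    (h : ∀ p : I × I, 0 ≤ dualFunction (φ, ψ, θ) p) :
    ∃ g : ℝ → ℝ, ConvexOn ℝ Set.univ g ∧ (∀ x : I, -φ x ≤ g x) ∧ ∀ y : I, g y ≤ ψ y := by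
  let a : I → ℝ → ℝ := fun x y => -φ x - θ x * (y - x)
  have hbdd : ∀ y, BddAbove (Set.range fun x => a x y) := fun y => by
    have hc : Continuous fun x => a x y := by fun_prop
    rw [← Set.image_univ]
    exact (isCompact_univ.image hc).bddAbove
  refine ⟨fun y => ⨆ x, a x y, ⟨convex_univ, fun y _ z _ s t hs ht hst => ?_⟩, fun x => ?_,
    fun y => ?_⟩
  · refine ciSup_le fun x => ?_
    have h1 := mul_le_mul_of_nonneg_left (le_ciSup (hbdd y) x) hs
    have h2 := mul_le_mul_of_nonneg_left (le_ciSup (hbdd z) x) ht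
    have h3 : a x (s • y + t • z) = s * a x y + t * a x z := by
      simp only [a, smul_eq_mul]
      linear_combination (-φ x + θ x * x) * hst.symm
    rw [h3]
    exact add_le_add h1 h2
  · simpa [a] using le_ciSup (hbdd x) x
  · refine ciSup_le fun x => ?_
    have := h (x, y)
    rw [dualFunction_apply] at this
    simp only [a]
    linarith

/-- If the dual function is nonnegative, a convex `k` lies between `-φ` and `ψ`, so `∫ φ ∂μ + ∫ ψ ∂ν
≥ ∫ k ∂ν - ∫ k ∂μ ≥ 0`. This is the positivity needed for the extension. -/
theorem exists_martingale_coupling (μ ν : Measure I) [IsProbabilityMeasure μ]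
    [IsProbabilityMeasure ν]
    (h : ∀ g : ℝ → ℝ, ConvexOn ℝ Set.univ g → ∫ x : I, g x ∂μ ≤ ∫ x : I, g x ∂ν) :
    ∃ π : Measure (I × I), IsFiniteMeasure π ∧ π.fst = μ ∧ π.snd = ν ∧
      ∀ θ : C(I, ℝ), ∫ p, θ p.1 * ((p.2 : ℝ) - p.1) ∂π = 0 := by
  obtain ⟨g, hg, hgs⟩ := exists_nonneg_extension_of_range (nonnegCone (I × I)) dualFunction
    (dualValue μ ν) (fun ⟨φ, ψ, θ⟩ hz => by
      obtain ⟨k, hk, hφ, hψ⟩ := exists_convexOn_between hz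
      let k' : C(I, ℝ) := ⟨fun x => k x, hk.continuous_of_univ.comp continuous_subtype_val⟩
      have h1 : ∫ x, -φ x ∂μ ≤ ∫ x, k' x ∂μ :=
        integral_mono (φ.integrable_of_compactSpace μ).neg (k'.integrable_of_compactSpace μ) hφ
      have h2 : ∫ x, k' x ∂ν ≤ ∫ x, ψ x ∂ν :=
        integral_mono (k'.integrable_of_compactSpace ν) (ψ.integrable_of_compactSpace ν) hψ
      have h3 : ∫ x, k' x ∂μ ≤ ∫ x, k' x ∂ν := h k hk
      rw [integral_neg] at h1
      rw [dualValue_apply]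
      linarith)
    (fun F => by
      -- Constants lie in the range and dominate every continuous function on the compact square.
      refine ⟨(.const I ‖F‖, 0, 0), mem_nonnegCone.2 fun p => ?_⟩
      have := (abs_le.1 (F.norm_coe_le_norm p)).1
      simp only [ContinuousMap.add_apply, dualFunction_apply, ContinuousMap.const_apply,
        ContinuousMap.zero_apply, zero_mul, add_zero]
      linarith)
  obtain ⟨π, hπ, hint⟩ := exists_measure_of_nonneg_functional g hgs
  have key : ∀ φ ψ θ : C(I, ℝ),
      ∫ p, (φ p.1 + ψ p.2 + θ p.1 * ((p.2 : ℝ) - p.1)) ∂π = ∫ x, φ x ∂μ + ∫ y, ψ y ∂ν :=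
    fun φ ψ θ => (hint (dualFunction (φ, ψ, θ))).trans (hg _)
  refine ⟨π, hπ, ?_, ?_, fun θ => by simpa using key 0 0 θ⟩
  · refine Measure.ext_of_forall_integral_continuousMap fun F => ?_
    rw [Measure.fst, integral_map measurable_fst.aemeasurable F.continuous.aestronglyMeasurable]
    simpa using key F 0 0
  · refine Measure.ext_of_forall_integral_continuousMap fun F => ?_
    rw [Measure.snd, integral_map measurable_snd.aemeasurable F.continuous.aestronglyMeasurable]
    simpa using key 0 F 0

/-- Passes from continuous test functions to Borel sets: weighting `π` by either nonnegative
coordinate and projecting to the first factor gives finite measures that agree on continuous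
functions, hence coincide. -/
theorem setIntegral_fst_eq_snd {π : Measure (I × I)} [IsFiniteMeasure π]
    (h : ∀ θ : C(I, ℝ), ∫ p, θ p.1 * ((p.2 : ℝ) - p.1) ∂π = 0) {s : Set I}
    (hs : MeasurableSet s) :
    ∫ p in Prod.fst ⁻¹' s, (p.1 : ℝ) ∂π = ∫ p in Prod.fst ⁻¹' s, (p.2 : ℝ) ∂π := by
  let u : C(I × I, ℝ) := ⟨fun p => (p.1 : ℝ), by fun_prop⟩
  let v : C(I × I, ℝ) := ⟨fun p => (p.2 : ℝ), by fun_prop⟩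
  have hfin : ∀ w : C(I × I, ℝ),
      IsFiniteMeasure (π.withDensity fun p => ENNReal.ofReal (w p)) := fun w =>
    isFiniteMeasure_withDensity_ofReal (w.integrable_of_compactSpace π).2
  have := hfin u
  have := hfin v
  have hmeas : ∀ w : C(I × I, ℝ), Measurable fun p => (w p).toNNReal := fun w =>
    w.continuous.measurable.real_toNNReal
  have hmap : ∀ w : C(I × I, ℝ), (∀ p, 0 ≤ w p) → ∀ F : C(I, ℝ),
      ∫ x, F x ∂(π.withDensity fun p => ENNReal.ofReal (w p)).map Prod.fst =
        ∫ p, F p.1 * w p ∂π := fun w hw F => by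
    rw [integral_map measurable_fst.aemeasurable F.continuous.aestronglyMeasurable]
    change ∫ p, F p.1 ∂(π.withDensity fun p => ((w p).toNNReal : ENNReal)) = _
    rw [integral_withDensity_eq_integral_smul (hmeas w)]
    refine integral_congr_ae (.of_forall fun p => ?_)
    simp [NNReal.smul_def, hw p, mul_comm]
  have hset : ∀ w : C(I × I, ℝ), (∀ p, 0 ≤ w p) →
      ∫ p in Prod.fst ⁻¹' s, w p ∂π =
        ((π.withDensity fun p => ENNReal.ofReal (w p)).map Prod.fst s).toReal := fun w hw => by
    rw [Measure.map_apply measurable_fst hs, withDensity_apply _ (measurable_fst hs),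
      integral_eq_lintegral_of_nonneg_ae (.of_forall hw) w.continuous.aestronglyMeasurable]
  have hu : ∀ p, 0 ≤ u p := fun p => p.1.2.1
  have hv : ∀ p, 0 ≤ v p := fun p => p.2.2.1
  have heq : (π.withDensity fun p => ENNReal.ofReal (u p)).map Prod.fst =
      (π.withDensity fun p => ENNReal.ofReal (v p)).map Prod.fst := by
    refine Measure.ext_of_forall_integral_continuousMap fun F => ?_
    rw [hmap u hu, hmap v hv, eq_comm, ← sub_eq_zero]
    let Fu : C(I × I, ℝ) := ⟨fun p => F p.1 * u p, by fun_prop⟩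
    let Fv : C(I × I, ℝ) := ⟨fun p => F p.1 * v p, by fun_prop⟩
    refine (integral_sub (Fv.integrable_of_compactSpace π)
      (Fu.integrable_of_compactSpace π)).symm.trans
        ((integral_congr_ae (.of_forall fun p => ?_)).trans (h F))
    exact (mul_sub _ _ _).symm
  exact (hset u hu).trans ((congrArg (fun ρ : Measure I => (ρ s).toReal) heq).trans
    (hset v hv).symm)

/-! ### Sufficiency -/

/-- Disintegrate `π` over its first marginal and simulate the conditional kernel from a uniform
variable. -/
theorem exists_measurable_map_prod_eq (π : Measure (I × I)) [IsFiniteMeasure π] :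
    ∃ g : I × I → I, Measurable g ∧
      (π.fst.prod volume).map (fun p => (p.1, g p)) = π := by
  obtain ⟨f, hf, hfπ⟩ := π.condKernel.exists_measurable_map_eq_unitInterval
  refine ⟨Function.uncurry f, hf, ?_⟩
  have hm : Measurable fun p : I × I => (p.1, Function.uncurry f p) := measurable_fst.prodMk hf
  conv_rhs => rw [← π.disintegrate π.condKernel]
  ext s hs
  rw [Measure.map_apply hm hs, Measure.prod_apply (hm hs), Measure.compProd_apply hs]
  refine lintegral_congr fun x => ?_
  rw [← hfπ x, Measure.map_apply hf.of_uncurry_left (measurable_prodMk_left hs)]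
  rfl

theorem map_coe_unitInterval : (volume : Measure I).map ((↑) : I → ℝ) = uniformLaw :=
  map_comap_subtype_coe measurableSet_Icc volume

/-- A nonnegative `h` always has an extended expectation, so no integrability under `μ` is needed.
-/
theorem ConvexOrderLE.ae_eq_zero {μ ν : Measure ℝ} {h : ℝ → ℝ} (hμν : ConvexOrderLE μ ν)
    (hh : ConvexOn ℝ Set.univ h) (h0 : ∀ x, 0 ≤ h x) (hν : ∀ᵐ x ∂ν, h x = 0) :
    ∀ᵐ x ∂μ, h x = 0 := by
  have hneg : ∀ ρ : Measure ℝ, ∫⁻ x, ENNReal.ofReal (-h x) ∂ρ = 0 := fun ρ => by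
    simp [ENNReal.ofReal_of_nonpos (neg_nonpos.2 (h0 _))]
  have hνint : ∫⁻ x, ENNReal.ofReal (h x) ∂ν = 0 := by
    rw [lintegral_congr_ae (hν.mono fun x hx => by rw [hx]), ENNReal.ofReal_zero, lintegral_zero]
  have := hμν h hh (Or.inr (by simp [hneg])) (Or.inr (by simp [hneg]))
  simp only [extExpectation, hneg, hνint, EReal.coe_ennreal_zero, sub_zero] at this
  have hμint : ∫⁻ x, ENNReal.ofReal (h x) ∂μ = 0 :=
    le_antisymm (EReal.coe_ennreal_le_coe_ennreal_iff.1 (by simpa using this)) bot_le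
  rw [lintegral_eq_zero_iff hh.continuous_of_univ.measurable.ennreal_ofReal] at hμint
  exact hμint.mono fun x hx => le_antisymm (ENNReal.ofReal_eq_zero.1 hx) (h0 x)

theorem IsSubUniform.ae_mem_Icc {μ : Measure ℝ} (hμ : IsSubUniform μ) :
    ∀ᵐ x ∂μ, x ∈ Set.Icc (0 : ℝ) 1 := by
  -- The convex functions `(-x)⁺` and `(x - 1)⁺` vanish exactly on `[0, ∞)` and `(-∞, 1]`.
  have h1 : ∀ᵐ x ∂μ, max (-x) 0 = 0 := hμ.ae_eq_zero
    ((concaveOn_id convex_univ).neg.sup (convexOn_const 0 convex_univ)) (fun _ => le_max_right _ _)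
    (ae_mem_Icc_uniformLaw.mono fun x hx => max_eq_right (neg_nonpos.2 hx.1))
  have h2 : ∀ᵐ x ∂μ, max (x - 1) 0 = 0 := hμ.ae_eq_zero
    (((convexOn_id convex_univ).sub (concaveOn_const 1 convex_univ)).sup
      (convexOn_const 0 convex_univ)) (fun _ => le_max_right _ _)
    (ae_mem_Icc_uniformLaw.mono fun x hx => max_eq_right (sub_nonpos.2 hx.2))
  filter_upwards [h1, h2] with x hx hx'
  exact ⟨neg_nonpos.1 (max_eq_right_iff.1 hx), sub_nonpos.1 (max_eq_right_iff.1 hx')⟩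

theorem IsSubUniform.exists_unitInterval_map_eq {μ : Measure ℝ} [IsProbabilityMeasure μ]
    (hμ : IsSubUniform μ) :
    ∃ μ₀ : Measure I, IsProbabilityMeasure μ₀ ∧ μ₀.map ((↑) : I → ℝ) = μ ∧
      ∀ g : ℝ → ℝ, ConvexOn ℝ Set.univ g → ∫ x : I, g x ∂μ₀ ≤ ∫ x : I, g x := by
  have hproj : Measurable (Set.projIcc (0 : ℝ) 1 zero_le_one) := continuous_projIcc.measurable
  have hmap : (μ.map (Set.projIcc (0 : ℝ) 1 zero_le_one)).map ((↑) : I → ℝ) = μ := by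
    rw [Measure.map_map measurable_subtype_coe hproj]
    refine (Measure.map_congr (hμ.ae_mem_Icc.mono fun x hx => ?_)).trans Measure.map_id
    exact congrArg Subtype.val (Set.projIcc_of_mem zero_le_one hx)
  refine ⟨_, Measure.isProbabilityMeasure_map hproj.aemeasurable, hmap, fun g hg => ?_⟩
  have hc := hg.continuous_of_univ
  have hi := hc.integrable_of_ae_mem_compact isCompact_Icc hμ.ae_mem_Icc
  have hi' := hc.integrable_of_ae_mem_compact isCompact_Icc ae_mem_Icc_uniformLaw
  have h := hμ g hg (expectationExists_of_integrable hi) (expectationExists_of_integrable hi')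
  rw [extExpectation_eq_integral hi, extExpectation_eq_integral hi', EReal.coe_le_coe_iff,
    ← map_coe_unitInterval, integral_map measurable_subtype_coe.aemeasurable
      hc.aestronglyMeasurable] at h
  refine le_of_eq_of_le ?_ h
  rw [← integral_map (f := g) measurable_subtype_coe.aemeasurable hc.aestronglyMeasurable, hmap]

/-- The sign turns the upper tail into the distribution function, which is the identity for a
uniform variable. -/
theorem pValue_neg_eq_of_map_eq_volume {Ω : Type*} [MeasurableSpace Ω] {P : Measure Ω}
    {U : Ω → I} (hU : Measurable U) (hlaw : P.map U = volume) :
    pValue P (fun ω => -(U ω : ℝ)) = fun ω => (U ω : ℝ) := by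
  ext ω
  have hset : {ω' | -(U ω : ℝ) ≤ -(U ω' : ℝ)} = U ⁻¹' Set.Iic (U ω) := by
    ext ω'
    simp
  rw [pValue, hset, ← map_measureReal_apply hU measurableSet_Iic, hlaw, measureReal_def,
    unitInterval.volume_Iic, ENNReal.toReal_ofReal (U ω).2.1]

theorem map_neg_coe_absolutelyContinuous {Ω : Type*} [MeasurableSpace Ω] {P : Measure Ω}
    {U : Ω → I} (hU : Measurable U) (hlaw : P.map U = volume) :
    P.map (fun ω => -(U ω : ℝ)) ≪ volume := by
  have h : P.map (fun ω => -(U ω : ℝ)) = uniformLaw.map Neg.neg := by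
    rw [← map_coe_unitInterval, ← hlaw, Measure.map_map measurable_subtype_coe hU,
      Measure.map_map measurable_neg (measurable_subtype_coe.comp hU)]
    rfl
  rw [h]
  refine (Measure.absolutelyContinuous_of_le Measure.restrict_le_self).map measurable_neg |>.trans ?_
  exact (Measure.map_neg_eq_self (volume : Measure ℝ)).absolutelyContinuous

theorem exists_isGeneralisedMidPValue_of_coupling (π : Measure (I × I)) [IsFiniteMeasure π]
    (μ₀ : Measure I) [IsProbabilityMeasure μ₀] (hfst : π.fst = μ₀) (hsnd : π.snd = volume)
    (hmart : ∀ θ : C(I, ℝ), ∫ p, θ p.1 * ((p.2 : ℝ) - p.1) ∂π = 0) :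
    ∃ (Ω : Type u) (_ : MeasurableSpace Ω) (P : Measure Ω) (Q : Ω → ℝ),
      IsProbabilityMeasure P ∧ IsGeneralisedMidPValue.{u, v, w} P Q ∧
        HasLaw Q (μ₀.map ((↑) : I → ℝ)) P := by
  obtain ⟨g, hg, hgπ⟩ := exists_measurable_map_prod_eq π
  rw [hfst] at hgπ
  -- `ULift` only moves the square into the required universe.
  let P : Measure (ULift.{u} (I × I)) := (μ₀.prod volume).map ULift.up
  have hup : Measurable (ULift.up : I × I → ULift.{u} (I × I)) := measurable_up
  have hP : IsProbabilityMeasure P := Measure.isProbabilityMeasure_map hup.aemeasurable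
  let X : ULift.{u} (I × I) → I := fun ω => ω.down.1
  let V : ULift.{u} (I × I) → I := fun ω => ω.down.2
  let U : ULift.{u} (I × I) → I := fun ω => g (X ω, V ω)
  have hX : Measurable X := measurable_fst.comp measurable_down
  have hV : Measurable V := measurable_snd.comp measurable_down
  have hU : Measurable U := hg.comp (hX.prodMk hV)
  have hXV : P.map (fun ω => (X ω, V ω)) = μ₀.prod volume := by
    rw [Measure.map_map (hX.prodMk hV) hup]
    exact Measure.map_id
  have hXU : P.map (fun ω => (X ω, U ω)) = π := by
    rw [← hgπ, ← hXV, Measure.map_map (measurable_fst.prodMk hg) (hX.prodMk hV)]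
    rfl
  have hXlaw : P.map X = μ₀ := by
    rw [← hfst, ← hXU, Measure.fst, Measure.map_map measurable_fst (hX.prodMk hU)]
    rfl
  have hUlaw : P.map U = volume := by
    rw [← hsnd, ← hXU, Measure.snd, Measure.map_map measurable_snd (hX.prodMk hU)]
    rfl
  have hVlaw : P.map V = volume := by
    have := congrArg Measure.snd hXV
    rwa [Measure.snd_map_prodMk hX, Measure.snd_prod] at this
  have hind : IndepFun X V P := by
    rw [indepFun_iff_map_prod_eq_prod_map_map hX.aemeasurable hV.aemeasurable, hXlaw, hVlaw, hXV]
  have hbound : ∀ W : ULift.{u} (I × I) → I, Measurable W → Integrable (fun ω => (W ω : ℝ)) P :=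
    fun W hW => .of_bound (measurable_subtype_coe.comp hW).aestronglyMeasurable 1
      (.of_forall fun ω => by
        rw [Real.norm_eq_abs, abs_of_nonneg (W ω).2.1]
        exact (W ω).2.2)
  refine ⟨ULift.{u} (I × I), inferInstance, P, fun ω => (X ω : ℝ), hP,
    ⟨ULift.{v} I, inferInstance, ULift.{w} I, inferInstance, fun ω => ⟨X ω⟩, fun ω => ⟨V ω⟩,
      fun p => -(g (p.1.down, p.2.down) : ℝ), ⟨measurable_up.comp hX, measurable_up.comp hV,
        hind.comp measurable_up measurable_up, ?_, map_neg_coe_absolutelyContinuous hU hUlaw⟩, ?_⟩,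
    ⟨(measurable_subtype_coe.comp hX).aemeasurable, ?_⟩⟩
  · exact (measurable_subtype_coe.comp (hg.comp ((measurable_down.comp measurable_fst).prodMk
      (measurable_down.comp measurable_snd)))).neg
  · have hD : Measurable fun ω => (ULift.up (X ω) : ULift.{v} I) := measurable_up.comp hX
    change (fun ω => (X ω : ℝ)) =ᵐ[P] P[pValue P (fun ω => -(U ω : ℝ)) | _]
    rw [pValue_neg_eq_of_map_eq_volume hU hUlaw]
    -- Events of `σ(X)` are preimages under the first coordinate, so the martingale identity for `π`
    -- is the defining property of `E(U | X)`.
    refine ae_eq_condExp_of_forall_setIntegral_eq hD.comap_le (hbound U hU)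
      (fun _ _ _ => (hbound X hX).integrableOn) ?_ ?_
    · rintro _ ⟨s, hs, rfl⟩ -
      have hs' : MeasurableSet (ULift.up ⁻¹' s : Set I) := measurable_up hs
      have hmap : ∀ k : I × I → ℝ, Measurable k →
          ∫ ω in (fun ω => (ULift.up (X ω) : ULift.{v} I)) ⁻¹' s, k (X ω, U ω) ∂P =
            ∫ p in Prod.fst ⁻¹' (ULift.up ⁻¹' s : Set I), k p ∂π := fun k hk => by
        rw [← hXU, setIntegral_map (measurable_fst hs') hk.aestronglyMeasurable
          (hX.prodMk hU).aemeasurable]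
        rfl
      exact (hmap (fun p => p.1) (measurable_subtype_coe.comp measurable_fst)).trans
        ((setIntegral_fst_eq_snd hmart hs').trans
          (hmap (fun p => p.2) (measurable_subtype_coe.comp measurable_snd)).symm)
    · exact ((measurable_subtype_coe.comp (measurable_down.comp
        (comap_measurable fun ω => (ULift.up (X ω) : ULift.{v} I))))).aestronglyMeasurable
  · rw [← hXlaw, Measure.map_map measurable_subtype_coe hX]
    rfl

theorem lemma2 (μ : Measure ℝ) :
    (IsProbabilityMeasure μ ∧ IsSubUniform μ) ↔
      ∃ (Ω : Type u) (_ : MeasurableSpace Ω) (P : Measure Ω) (Q : Ω → ℝ),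
        IsProbabilityMeasure P ∧ IsGeneralisedMidPValue.{u, v, w} P Q ∧ HasLaw Q μ P := by
  constructor
  · rintro ⟨hμ, hsub⟩
    obtain ⟨μ₀, hμ₀, rfl, hconv⟩ := hsub.exists_unitInterval_map_eq
    obtain ⟨π, hπ, hfst, hsnd, hmart⟩ := exists_martingale_coupling μ₀ volume hconv
    exact exists_isGeneralisedMidPValue_of_coupling π μ₀ hfst hsnd hmart
  · rintro ⟨Ω, _, P, Q, hP, hQ, hlaw⟩
    rw [IsSubUniform, ← hlaw.map_eq]
    exact ⟨Measure.isProbabilityMeasure_map hlaw.aemeasurable, hQ.convexOrderLE⟩
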